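/- Let $\mathcal C$ be a finite non-empty set of topics and $\mathcal N$ a finite set of followers of a user $u$. Let $a_v \ge 0$ ($v \in \mathcal N$) and $a_u \ge 0$ be weights with $\sum_{v} a_v + a_u = 1$, let $x_c \in [0,1]$ ($c \in \mathcal C$) be the user's own preferences, let $q_{cv} \in [0,1]$ be the followers' true preferences, which are fixed and unknown to the user, and let $\alpha, \beta > 0$. At each time $t = 1, 2, \dots$ the user shares a story of a topic $c_t$, and then, given the past and $c_t$, the followers give feedback independently of each other: $l_v(c_t) \sim \mathrm{Bernoulli}(q_{c_t v})$. The user sees exactly the feedback given to her own stories. For a (possibly history-dependent) strategy of choosing the topics, its utility over $T$ steps is $$\mathrm{Util}(T) = \mathbb E\Big[\sum_{t=1}^T \Big(\sum_{v} a_v\, l_v(c_t) + a_u x_{c_t}\Big)\Big].$$ Posterior sampling algorithm (Algorithm 1 with posterior samples): at each time $t$, for each $(c,v)$ let $n_{cv}(t)$ and $\bar n_{cv}(t)$ be the numbers of stories of topic $c$ shared by the user before time $t$ to which $v$ did, respectively did not, give feedback; draw, given the history and independently over $(c,v)$, fresh samples $\hat q_{cv}(t) \sim \mathrm{Beta}(\alpha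 + n_{cv}(t), \beta + \bar n_{cv}(t))$; share a story of topic $c_t \in \arg\max_{c} \big(\sum_v a_v \hat q_{cv}(t) + a_u x_c\big)$, where ties are broken in an arbitrary predetermined way. Let $\mathrm{Util}(T)$ be the utility of this algorithm, let $\mathrm{Util}^*(T)$ be the utility of the strategy that always shares a topic in $\arg\max_c \big(\sum_v a_v q_{cv} + a_u x_c\big)$, and let $R(T) = \mathrm{Util}(T) - \mathrm{Util}^*(T)$ be the regret. Then $|R(T)| = O(\log T)$ as $T \to \infty$, where the implied constant may depend on all the parameters above but not on $T$. -/

import Mathlib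

noncomputable section

namespace Posting

open MeasureTheory ProbabilityTheory

/-- What happens in one time step, and is observed by the user: the topic of the story that she
shares, and for each follower whether that follower gave feedback to this story. -/
abbrev Round (C N : Type*) : Type _ := C × (N → Bool)

/-- The feedback history after `t` stories of the user. It only holds the feedback that the
followers gave to the user herself: follower `v` contributes the pairs `((H s).1, (H s).2 v)`. -/
abbrev History (C N : Type*) (t : ℕ) : Type _ := Fin t → Round C N

/-- Number of stories of topic `c` to which follower `v` gave feedback. -/
def posCount {C N : Type*} [DecidableEq C] {t : ℕ} (H : History C N t) (c : C) (v : N) : ℕ :=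
  (Finset.univ.filter fun s : Fin t => (H s).1 = c ∧ (H s).2 v = true).card

/-- Number of stories of topic `c` to which follower `v` did not give feedback. -/
def negCount {C N : Type*} [DecidableEq C] {t : ℕ} (H : History C N t) (c : C) (v : N) : ℕ :=
  (Finset.univ.filter fun s : Fin t => (H s).1 = c ∧ (H s).2 v = false).card

/-- The value `∑ v, a v * q c v + au * x c` of topic `c` under the preferences `q`. -/
def score {C N : Type*} [Fintype N] (a : N → ℝ) (au : ℝ) (x : C → ℝ) (q : C → N → ℝ) (c : C) : ℝ :=
  ∑ v, a v * q c v + au * x c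

/-- A predetermined (measurable) way to choose a maximizer of a function on the topics. -/
def IsArgmaxRule {C : Type*} [MeasurableSpace C] (sel : (C → ℝ) → C) : Prop :=
  Measurable sel ∧ ∀ (s : C → ℝ) (c : C), s c ≤ s (sel s)

/-- A posting strategy: the distribution `p(c | H)` of the next topic given the history. -/
abbrev Strategy (C N : Type*) [MeasurableSpace C] : Type _ :=
  (t : ℕ) → History C N t → Measure C

/-- Given the topic `c`, the followers give feedback independently of each other, follower `v`
with probability `q c v`. -/
def feedbackLaw {C N : Type*} [Fintype N] (q : C → N → unitInterval) (c : C) : Measure (N → Bool) :=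
  Measure.pi fun v => bernoulliMeasure true false (q c v)

/-- The law of the history after `t` time steps: in each step the topic is drawn from the strategy,
then the feedback is drawn given the topic, and both are appended to the history. -/
def historyLaw {C N : Type*} [MeasurableSpace C] [Fintype N] (q : C → N → unitInterval)
    (p : Strategy C N) : (t : ℕ) → Measure (History C N t)
  | 0 => Measure.dirac Fin.elim0
  | t + 1 => (historyLaw q p t).bind fun H => (p t H).bind fun c =>
      (feedbackLaw q c).map fun l => (Fin.snoc H (c, l) : History C N (t + 1))

/-- The expected utility `E [∑ t, (∑ v, a v * l v (c t) + au * x (c t))]` of a strategy over `T`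
time steps, where the true preferences are `q`. -/
def util {C N : Type*} [MeasurableSpace C] [Fintype N] (a : N → ℝ) (au : ℝ) (x : C → ℝ)
    (q : C → N → unitInterval) (p : Strategy C N) (T : ℕ) : ℝ :=
  ∫ H : History C N T,
    ∑ t : Fin T, (∑ v, a v * (if (H t).2 v = true then 1 else 0) + au * x (H t).1)
    ∂(historyLaw q p T)

/-- The optimal strategy for known preferences: always share the topic of the largest value. -/
def optimalStrategy {C N : Type*} [MeasurableSpace C] [Fintype N] (sel : (C → ℝ) → C)
    (a : N → ℝ) (au : ℝ) (x : C → ℝ) (q : C → N → unitInterval) : Strategy C N :=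
  fun _ _ => Measure.dirac (sel (score a au x fun c v => (q c v : ℝ)))

/-- The posterior law of the preferences given the history, for independent `Beta(α, β)` priors. -/
def betaPosterior {C N : Type*} [Fintype C] [DecidableEq C] [Fintype N] (α β : ℝ) {t : ℕ}
    (H : History C N t) : Measure (C → N → ℝ) :=
  Measure.pi fun c => Measure.pi fun v => betaMeasure (α + posCount H c v) (β + negCount H c v)

/-- The posterior sampling algorithm: in each step draw fresh estimates of all preferences from the
posterior, and share the topic of the largest value under these estimates. -/
def posteriorSampling {C N : Type*} [Fintype C] [DecidableEq C] [MeasurableSpace C] [Fintype N]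
    (sel : (C → ℝ) → C) (a : N → ℝ) (au : ℝ) (x : C → ℝ) (α β : ℝ) : Strategy C N :=
  fun _ H => (betaPosterior α β H).map fun qhat => sel (score a au x qhat)

/-- The regret `Util(T) - Util*(T)` of the posterior sampling algorithm (a nonpositive number). -/
def regret {C N : Type*} [Fintype C] [DecidableEq C] [MeasurableSpace C] [Fintype N]
    (sel : (C → ℝ) → C) (a : N → ℝ) (au : ℝ) (x : C → ℝ) (q : C → N → unitInterval)
    (α β : ℝ) (T : ℕ) : ℝ :=
  util a au x q (posteriorSampling sel a au x α β) T
    - util a au x q (optimalStrategy sel a au x q) T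

end Posting

end

namespace Posting

open MeasureTheory ProbabilityTheory Set
open scoped ENNReal

/-! ### Comparison of Bernoulli likelihoods -/

/-! The regret is minus the sum over topics `c` of the gap of `c` times the expected number of plays
of `c` (`util_sub_eq_neg_sum`), so it suffices that a suboptimal `c` is played O(log T) times.

Let `d` be optimal and `y` a threshold between the two true scores. Either the sampled score of `c`
exceeds `y`, which is exponentially unlikely once `c` has many plays and typical feedback. Or `c`
wins with a score at most `y`; by independence of the samples this is at most `1 / p - 1` times as
likely as choosing `d`, where `p` is the posterior probability that the score of `d` exceeds `y`
(`posteriorSampling_singleton_le`). The second kind is thus charged to plays of `d`. Along these the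
feedback is i.i.d., whatever the strategy (`sum_lintegral_plays_le`), and the expectation of a bound
for `1 / p - 1` after `i` plays decays geometrically in `i`
(`exists_feedbackExp_inv_betaMeasure_le`), so the total is bounded. The first kind costs at most `L`
early plays, a bounded number of plays with atypical feedback, and `T * r ^ L` up to a constant; `L`
of order `log T` gives the claim.

All tail estimates come from comparing Bernoulli likelihoods at two parameters and integrating over
the beta prior. -/

/-- The log-likelihood is concave in the parameter, hence lies below its tangent at `y`; the
exponent is the slope there times `x - y`. -/
lemma pow_mul_one_sub_pow_le_exp_mul {x y : ℝ} (hx0 : 0 ≤ x) (hx1 : x ≤ 1) (hy0 : 0 < y)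
    (hy1 : y < 1) (i j : ℕ) :
    x ^ i * (1 - x) ^ j ≤
      Real.exp ((x - y) * (i - (i + j) * y) / (y * (1 - y))) * (y ^ i * (1 - y) ^ j) := by
  have h1y : 0 < 1 - y := by linarith
  have h1 : x ≤ y * Real.exp ((x - y) / y) := by
    have := Real.add_one_le_exp ((x - y) / y)
    calc x = y * ((x - y) / y + 1) := by field_simp; ring
      _ ≤ _ := by gcongr
  have h2 : 1 - x ≤ (1 - y) * Real.exp ((y - x) / (1 - y)) := by
    have := Real.add_one_le_exp ((y - x) / (1 - y))
    calc 1 - x = (1 - y) * ((y - x) / (1 - y) + 1) := by field_simp; ring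
      _ ≤ _ := by gcongr
  calc x ^ i * (1 - x) ^ j
      ≤ (y * Real.exp ((x - y) / y)) ^ i * ((1 - y) * Real.exp ((y - x) / (1 - y))) ^ j := by
        gcongr
    _ = (Real.exp (i * ((x - y) / y)) * Real.exp (j * ((y - x) / (1 - y)))) *
          (y ^ i * (1 - y) ^ j) := by
        rw [mul_pow, mul_pow, Real.exp_nat_mul, Real.exp_nat_mul]; ring
    _ = _ := by
        rw [← Real.exp_add]
        congr 2
        field_simp
        ring

/-- The likelihood of the parameter `x` for `i` successes and `j` failures. -/
noncomputable def likelihood (i j : ℕ) (x : ℝ) : ℝ≥0∞ := ENNReal.ofReal (x ^ i * (1 - x) ^ j)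

@[fun_prop]
lemma measurable_likelihood (i j : ℕ) : Measurable (likelihood i j) := by
  unfold likelihood; fun_prop

/-- The hypothesis puts `y` between `x` and the empirical frequency, with margins of product at
least `D` when `i + j > 0`. The denominator `y * (1 - y) ≤ 1` only helps and is dropped. -/
lemma likelihood_le_exp_mul {x y D : ℝ} (hx0 : 0 ≤ x) (hx1 : x ≤ 1) (hy0 : 0 < y)
    (hy1 : y < 1) (hD : 0 ≤ D) (i j : ℕ) (h : (x - y) * (i - (i + j) * y) ≤ -(D * (i + j))) :
    likelihood i j x ≤ ENNReal.ofReal (Real.exp (-D)) ^ (i + j) * likelihood i j y := by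
  have h1y : 0 < 1 - y := by linarith
  have hp : 0 < y * (1 - y) := mul_pos hy0 h1y
  have hp1 : y * (1 - y) ≤ 1 := by nlinarith
  rw [← ENNReal.ofReal_pow (Real.exp_pos _).le, likelihood, likelihood,
    ← ENNReal.ofReal_mul (by positivity)]
  apply ENNReal.ofReal_le_ofReal
  refine (pow_mul_one_sub_pow_le_exp_mul hx0 hx1 hy0 hy1 i j).trans ?_
  rw [← Real.exp_nat_mul]
  have : 0 ≤ D * (i + j : ℝ) := by positivity
  gcongr
  rw [div_le_iff₀ hp]
  push_cast
  nlinarith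

/-! ### Posterior of a beta prior -/

lemma betaMeasure_Iic_eq_zero {α β z : ℝ} (hz : z ≤ 0) : betaMeasure α β (Iic z) = 0 := by
  rw [betaMeasure, withDensity_apply _ measurableSet_Iic]
  exact setLIntegral_eq_zero measurableSet_Iic
    fun x hx => betaPDF_eq_zero_of_nonpos (le_trans hx hz)

lemma betaMeasure_Ici_eq_zero {α β z : ℝ} (hz : 1 ≤ z) : betaMeasure α β (Ici z) = 0 := by
  rw [betaMeasure, withDensity_apply _ measurableSet_Ici]
  exact setLIntegral_eq_zero measurableSet_Ici
    fun x hx => betaPDF_eq_zero_of_one_le (le_trans hz hx)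

lemma measurable_betaPDF (α β : ℝ) : Measurable (betaPDF α β) := by
  unfold betaPDF; fun_prop

lemma ae_betaMeasure_mem_Ioo (α β : ℝ) : ∀ᵐ x ∂betaMeasure α β, x ∈ Ioo (0 : ℝ) 1 := by
  have h1 : ∀ᵐ x ∂betaMeasure α β, x ∉ Iic (0 : ℝ) :=
    measure_eq_zero_iff_ae_notMem.1 (betaMeasure_Iic_eq_zero le_rfl)
  have h2 : ∀ᵐ x ∂betaMeasure α β, x ∉ Ici (1 : ℝ) :=
    measure_eq_zero_iff_ae_notMem.1 (betaMeasure_Ici_eq_zero le_rfl)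
  filter_upwards [h1, h2] with x hx1 hx2
  exact ⟨not_le.1 hx1, not_le.1 hx2⟩

lemma betaMeasure_Ioo_ne_zero {α β s t : ℝ} (hα : 0 < α) (hβ : 0 < β) (hs : 0 ≤ s) (hst : s < t)
    (ht : t ≤ 1) : betaMeasure α β (Ioo s t) ≠ 0 := by
  intro h
  rw [betaMeasure, withDensity_apply_eq_zero (measurable_betaPDF α β)] at h
  have : {x | betaPDF α β x ≠ 0} ∩ Ioo s t = Ioo s t := by
    refine inter_eq_right.2 fun x hx => ?_
    have := betaPDFReal_pos (hs.trans_lt hx.1) (hx.2.trans_le ht) hα hβ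
    simpa [betaPDF] using this
  rw [this, Real.volume_Ioo] at h
  simp at h
  linarith

/-- Conjugacy: likelihood times beta density is again a beta density, up to the ratio of normalizing
constants. -/
lemma setLIntegral_likelihood_betaMeasure {α β : ℝ} (hα : 0 < α) (hβ : 0 < β) (i j : ℕ)
    {A : Set ℝ} (hA : MeasurableSet A) :
    ∫⁻ x in A, likelihood i j x ∂betaMeasure α β =
      ENNReal.ofReal (beta (α + i) (β + j) / beta α β) * betaMeasure (α + i) (β + j) A := by
  have hb : 0 < beta α β := beta_pos hα hβ
  have hb' : 0 < beta (α + i) (β + j) := beta_pos (by positivity) (by positivity)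
  rw [betaMeasure, restrict_withDensity hA, lintegral_withDensity_eq_lintegral_mul _
    (measurable_betaPDF α β) (by fun_prop), betaMeasure, withDensity_apply _ hA,
    ← lintegral_const_mul _ (measurable_betaPDF _ _)]
  refine lintegral_congr fun x => ?_
  simp only [Pi.mul_apply, betaPDF, likelihood, betaPDFReal]
  split_ifs with hx
  · have h0 := hx.1
    have h1 : 0 < 1 - x := by linarith [hx.2]
    rw [← ENNReal.ofReal_mul (by positivity), ← ENNReal.ofReal_mul (by positivity)]
    congr 1
    rw [show α + i - 1 = (α - 1) + i by ring, show β + j - 1 = (β - 1) + j by ring,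
      Real.rpow_add_natCast h0.ne', Real.rpow_add_natCast h1.ne']
    field_simp
  · simp

lemma lintegral_likelihood_betaMeasure {α β : ℝ} (hα : 0 < α) (hβ : 0 < β) (i j : ℕ) :
    ∫⁻ x, likelihood i j x ∂betaMeasure α β =
      ENNReal.ofReal (beta (α + i) (β + j) / beta α β) := by
  have := isProbabilityMeasureBeta (α := α + i) (β := β + j) (by positivity) (by positivity)
  rw [← setLIntegral_univ, setLIntegral_likelihood_betaMeasure hα hβ i j .univ]
  simp

/-- Bayes' rule for a beta prior and Bernoulli observations. -/
lemma setLIntegral_likelihood_eq_lintegral_mul {α β : ℝ} (hα : 0 < α) (hβ : 0 < β) (i j : ℕ)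
    {A : Set ℝ} (hA : MeasurableSet A) :
    ∫⁻ x in A, likelihood i j x ∂betaMeasure α β =
      (∫⁻ x, likelihood i j x ∂betaMeasure α β) * betaMeasure (α + i) (β + j) A := by
  rw [setLIntegral_likelihood_betaMeasure hα hβ i j hA, lintegral_likelihood_betaMeasure hα hβ]

lemma lintegral_likelihood_ne_zero {α β : ℝ} (hα : 0 < α) (hβ : 0 < β) (i j : ℕ) :
    ∫⁻ x, likelihood i j x ∂betaMeasure α β ≠ 0 := by
  have hb : 0 < beta α β := beta_pos hα hβ
  have hb' : 0 < beta (α + i) (β + j) := beta_pos (by positivity) (by positivity)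
  rw [lintegral_likelihood_betaMeasure hα hβ]
  simp only [ne_eq, ENNReal.ofReal_eq_zero, not_le]
  positivity

lemma lintegral_likelihood_ne_top {α β : ℝ} (hα : 0 < α) (hβ : 0 < β) (i j : ℕ) :
    ∫⁻ x, likelihood i j x ∂betaMeasure α β ≠ ∞ := by
  rw [lintegral_likelihood_betaMeasure hα hβ]
  exact ENNReal.ofReal_ne_top

/-- Integrate the pointwise comparison over `A` and `J` against the prior; the marginal likelihood
from Bayes' rule cancels. -/
lemma betaMeasure_mul_le_of_likelihood_le {α β : ℝ} (hα : 0 < α) (hβ : 0 < β) (i j : ℕ)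
    {A J : Set ℝ} (hA : MeasurableSet A) (hJ : MeasurableSet J) {r : ℝ≥0∞}
    (h : ∀ x ∈ A, x ∈ Ioo (0 : ℝ) 1 → ∀ y ∈ J, y ∈ Ioo (0 : ℝ) 1 →
      likelihood i j x ≤ r * likelihood i j y) :
    betaMeasure (α + i) (β + j) A * betaMeasure α β J ≤ r * betaMeasure (α + i) (β + j) J := by
  have := isProbabilityMeasureBeta hα hβ
  have hae := ae_betaMeasure_mem_Ioo α β
  have key : (∫⁻ x in A, likelihood i j x ∂betaMeasure α β) * betaMeasure α β J ≤
      r * ∫⁻ y in J, likelihood i j y ∂betaMeasure α β := by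
    calc (∫⁻ x in A, likelihood i j x ∂betaMeasure α β) * betaMeasure α β J
        = ∫⁻ x in A, likelihood i j x * betaMeasure α β J ∂betaMeasure α β := by
          rw [lintegral_mul_const _ (by fun_prop)]
      _ ≤ ∫⁻ x in A, (r * ∫⁻ y in J, likelihood i j y ∂betaMeasure α β) ∂betaMeasure α β := by
          refine lintegral_mono_ae ?_
          filter_upwards [ae_restrict_of_ae hae, ae_restrict_mem hA] with x hx hxA
          rw [← setLIntegral_const, ← lintegral_const_mul _ (by fun_prop)]
          refine lintegral_mono_ae ?_
          filter_upwards [ae_restrict_of_ae hae, ae_restrict_mem hJ] with y hy hyJ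
          exact h x hxA hx y hyJ hy
      _ ≤ _ := by
          rw [setLIntegral_const]
          exact mul_le_of_le_one_right' prob_le_one
  rw [setLIntegral_likelihood_eq_lintegral_mul hα hβ i j hA,
    setLIntegral_likelihood_eq_lintegral_mul hα hβ i j hJ, mul_assoc, mul_left_comm r] at key
  exact (ENNReal.mul_le_mul_iff_right (lintegral_likelihood_ne_zero hα hβ i j)
    (lintegral_likelihood_ne_top hα hβ i j)).1 key

/-- Change of measure from the true parameter `x` to the prior mixture, leaving a factor of
posterior mass that can cancel an inverse posterior probability. -/
lemma likelihood_mul_betaMeasure_le {α β : ℝ} (hα : 0 < α) (hβ : 0 < β) (i j : ℕ)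
    {x : ℝ} {J : Set ℝ} (hJ : MeasurableSet J) {r : ℝ≥0∞}
    (h : ∀ y ∈ J, y ∈ Ioo (0 : ℝ) 1 → likelihood i j x ≤ r * likelihood i j y) :
    likelihood i j x * betaMeasure α β J ≤
      r * ((∫⁻ y, likelihood i j y ∂betaMeasure α β) * betaMeasure (α + i) (β + j) J) := by
  rw [← setLIntegral_likelihood_eq_lintegral_mul hα hβ i j hJ, ← setLIntegral_const,
    ← lintegral_const_mul _ (by fun_prop)]
  refine lintegral_mono_ae ?_
  filter_upwards [ae_restrict_of_ae (ae_betaMeasure_mem_Ioo α β), ae_restrict_mem hJ] with y hy hyJ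
  exact h y hyJ hy

/-! ### Binomial expectations -/

/-- The expectation of `g i j` for the numbers `i` of successes and `j` of failures in `k`
independent Bernoulli trials of parameter `x`. -/
noncomputable def binomExp (x : ℝ) (k : ℕ) (g : ℕ → ℕ → ℝ≥0∞) : ℝ≥0∞ :=
  ∑ p ∈ Finset.HasAntidiagonal.antidiagonal k, (k.choose p.1 : ℝ≥0∞) * (likelihood p.1 p.2 x * g p.1 p.2)

lemma sum_choose_mul_likelihood {x : ℝ} (hx0 : 0 ≤ x) (hx1 : x ≤ 1) (k : ℕ) :
    ∑ p ∈ Finset.HasAntidiagonal.antidiagonal k, (k.choose p.1 : ℝ≥0∞) * likelihood p.1 p.2 x = 1 := by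
  have h1 : 0 ≤ 1 - x := by linarith
  have := (Commute.all (ENNReal.ofReal x) (ENNReal.ofReal (1 - x))).add_pow' k
  rw [← ENNReal.ofReal_add hx0 h1] at this
  simp only [add_sub_cancel, ENNReal.ofReal_one, one_pow, nsmul_eq_mul] at this
  rw [this]
  refine Finset.sum_congr rfl fun p _ => ?_
  rw [likelihood, ENNReal.ofReal_mul (by positivity), ENNReal.ofReal_pow hx0,
    ENNReal.ofReal_pow h1]

lemma binomExp_one {x : ℝ} (hx0 : 0 ≤ x) (hx1 : x ≤ 1) (k : ℕ) :
    binomExp x k (fun _ _ => 1) = 1 := by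
  simpa [binomExp] using sum_choose_mul_likelihood hx0 hx1 k

lemma sum_choose_mul_lintegral_likelihood {α β : ℝ} (hα : 0 < α) (hβ : 0 < β) (k : ℕ) :
    ∑ p ∈ Finset.HasAntidiagonal.antidiagonal k,
      (k.choose p.1 : ℝ≥0∞) * ∫⁻ x, likelihood p.1 p.2 x ∂betaMeasure α β = 1 := by
  have := isProbabilityMeasureBeta hα hβ
  simp_rw [← lintegral_const_mul _ (measurable_likelihood _ _)]
  rw [← lintegral_finsetSum _ (by fun_prop)]
  rw [lintegral_congr_ae (g := fun _ => 1)]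
  · simp
  · filter_upwards [ae_betaMeasure_mem_Ioo α β] with x hx
    exact sum_choose_mul_likelihood hx.1.le hx.2.le k

end Posting

namespace Posting

open MeasureTheory ProbabilityTheory Set
open scoped ENNReal

lemma ofReal_exp_neg_lt_one {D : ℝ} (hD : 0 < D) : ENNReal.ofReal (Real.exp (-D)) < 1 := by
  rw [ENNReal.ofReal_lt_one, Real.exp_lt_one_iff]; linarith

/-! ### Concentration of the posterior -/

/-- An interval strictly between `z` and `w` explains the data exponentially better than any point
below `z`. The bound is relative to the mass above `z`, since the odds `1 / p - 1` have to be small.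
-/
lemma exists_betaMeasure_Iic_le {α β z w : ℝ} (hα : 0 < α) (hβ : 0 < β) (hzw : z < w)
    (hw : w ≤ 1) :
    ∃ K r : ℝ≥0∞, K ≠ ∞ ∧ r < 1 ∧ ∀ i j : ℕ, w * (i + j) ≤ i →
      betaMeasure (α + i) (β + j) (Iic z) ≤
        K * r ^ (i + j) * betaMeasure (α + i) (β + j) (Ioi z) := by
  rcases lt_or_ge z 0 with hz | hz
  · refine ⟨0, 0, by simp, by simp, fun i j _ => ?_⟩
    rw [betaMeasure_Iic_eq_zero hz.le]
    exact zero_le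
  set s := z + (w - z) / 3 with hs
  set t := z + 2 * (w - z) / 3 with ht
  have hJ : betaMeasure α β (Ioo s t) ≠ 0 :=
    betaMeasure_Ioo_ne_zero hα hβ (by linarith) (by linarith) (by linarith)
  have := isProbabilityMeasureBeta hα hβ
  have hD : 0 < (s - z) * (w - t) := mul_pos (by linarith) (by linarith)
  refine ⟨(betaMeasure α β (Ioo s t))⁻¹, ENNReal.ofReal (Real.exp (-((s - z) * (w - t)))),
    ENNReal.inv_ne_top.2 hJ, ofReal_exp_neg_lt_one hD, fun i j hij => ?_⟩
  have key := betaMeasure_mul_le_of_likelihood_le hα hβ i j (A := Iic z) (J := Ioo s t)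
    measurableSet_Iic measurableSet_Ioo
    (r := ENNReal.ofReal (Real.exp (-((s - z) * (w - t)))) ^ (i + j)) (by
      intro x hx hx01 y hy hy01
      refine likelihood_le_exp_mul hx01.1.le hx01.2.le hy01.1 hy01.2 hD.le i j ?_
      have h1 : s - z ≤ y - x := by linarith [hx.out, hy.1]
      have h2 : (w - t) * (i + j) ≤ i - (i + j) * y := by
        have : (y : ℝ) * (i + j) ≤ t * (i + j) := by gcongr; exact hy.2.le
        nlinarith
      have h3 : 0 ≤ (w - t) * (i + j : ℝ) := mul_nonneg (by linarith) (by positivity)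
      have := mul_le_mul h1 h2 h3 (by linarith)
      nlinarith)
  rw [mul_assoc, ← ENNReal.div_eq_inv_mul,
    ENNReal.le_div_iff_mul_le (Or.inl hJ) (Or.inl (measure_ne_top _ _))]
  refine key.trans ?_
  gcongr
  exact fun y hy => lt_trans (by linarith) hy.1

lemma exists_betaMeasure_Ioi_le {α β z w : ℝ} (hα : 0 < α) (hβ : 0 < β) (hzw : w < z)
    (hw : 0 ≤ w) :
    ∃ K r : ℝ≥0∞, K ≠ ∞ ∧ r < 1 ∧ ∀ i j : ℕ, (i : ℝ) ≤ w * (i + j) →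
      betaMeasure (α + i) (β + j) (Ioi z) ≤ K * r ^ (i + j) := by
  rcases le_or_gt 1 z with hz | hz
  · refine ⟨0, 0, by simp, by simp, fun i j _ => ?_⟩
    rw [measure_mono_null Ioi_subset_Ici_self (betaMeasure_Ici_eq_zero hz)]
    exact zero_le
  set s := w + (z - w) / 3 with hs
  set t := w + 2 * (z - w) / 3 with ht
  have hJ : betaMeasure α β (Ioo s t) ≠ 0 :=
    betaMeasure_Ioo_ne_zero hα hβ (by linarith) (by linarith) (by linarith)
  have := isProbabilityMeasureBeta hα hβ
  have hD : 0 < (z - t) * (s - w) := mul_pos (by linarith) (by linarith)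
  refine ⟨(betaMeasure α β (Ioo s t))⁻¹, ENNReal.ofReal (Real.exp (-((z - t) * (s - w)))),
    ENNReal.inv_ne_top.2 hJ, ofReal_exp_neg_lt_one hD, fun i j hij => ?_⟩
  have := isProbabilityMeasureBeta (α := α + i) (β := β + j) (by positivity) (by positivity)
  have key := betaMeasure_mul_le_of_likelihood_le hα hβ i j (A := Ioi z) (J := Ioo s t)
    measurableSet_Ioi measurableSet_Ioo
    (r := ENNReal.ofReal (Real.exp (-((z - t) * (s - w)))) ^ (i + j)) (by
      intro x hx hx01 y hy hy01
      refine likelihood_le_exp_mul hx01.1.le hx01.2.le hy01.1 hy01.2 hD.le i j ?_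
      have h1 : z - t ≤ x - y := by linarith [hx.out, hy.2]
      have h2 : (s - w) * (i + j) ≤ (i + j) * y - i := by
        have : (s : ℝ) * (i + j) ≤ y * (i + j) := by gcongr; exact hy.1.le
        nlinarith
      have h3 : 0 ≤ (s - w) * (i + j : ℝ) := mul_nonneg (by linarith) (by positivity)
      have := mul_le_mul h1 h2 h3 (by linarith)
      nlinarith)
  rw [← ENNReal.div_eq_inv_mul,
    ENNReal.le_div_iff_mul_le (Or.inl hJ) (Or.inl (measure_ne_top _ _))]
  exact key.trans (mul_le_of_le_one_right' prob_le_one)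

/-! ### Moments of binomial variables -/

/-- Chernoff bound by tilting: on the event the likelihood at `x` is exponentially smaller than at
the midpoint `m`, and the likelihoods at `m` sum to one. -/
lemma exists_binomExp_indicator_le {x w : ℝ} (hx0 : 0 ≤ x) (hx1 : x ≤ 1) (hxw : x < w) :
    ∃ r : ℝ≥0∞, r < 1 ∧ ∀ k : ℕ,
      binomExp x k (fun i j => if w * (i + j) < i then 1 else 0) ≤ r ^ k := by
  rcases le_or_gt 1 w with hw | hw
  · refine ⟨0, by simp, fun k => ?_⟩
    rw [binomExp, Finset.sum_eq_zero]
    · exact zero_le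
    intro p _
    rw [if_neg, mul_zero, mul_zero]
    have h1 : (0 : ℝ) ≤ p.1 := by positivity
    have h2 : (0 : ℝ) ≤ p.2 := by positivity
    nlinarith
  set m := (x + w) / 2 with hm
  have hD : 0 < (m - x) * (w - m) := mul_pos (by linarith) (by linarith)
  refine ⟨ENNReal.ofReal (Real.exp (-((m - x) * (w - m)))), ofReal_exp_neg_lt_one hD, fun k => ?_⟩
  calc binomExp x k (fun i j => if w * (i + j) < i then 1 else 0)
      ≤ ∑ p ∈ Finset.HasAntidiagonal.antidiagonal k,
          ENNReal.ofReal (Real.exp (-((m - x) * (w - m)))) ^ k *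
            ((k.choose p.1 : ℝ≥0∞) * likelihood p.1 p.2 m) := by
        refine Finset.sum_le_sum fun p hp => ?_
        rw [Finset.HasAntidiagonal.mem_antidiagonal] at hp
        dsimp only
        split_ifs with h
        · rw [mul_one, mul_left_comm, ← hp]
          gcongr
          refine likelihood_le_exp_mul hx0 hx1 (by linarith) (by linarith) hD.le _ _ ?_
          have h2 : (w - m) * (p.1 + p.2) ≤ p.1 - (p.1 + p.2) * m := by nlinarith
          nlinarith
        · simp
    _ = _ := by
        rw [← Finset.mul_sum, sum_choose_mul_likelihood (by linarith) (by linarith), mul_one]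

/-- The posterior probability of an interval above `z` is rarely small if the true parameter is
larger than `z`. -/
lemma exists_binomExp_inv_betaMeasure_Ioi_le {α β x z : ℝ} (hα : 0 < α) (hβ : 0 < β)
    (hx1 : x ≤ 1) (hx0 : 0 ≤ x) (hzx : z < x) :
    ∃ K r : ℝ≥0∞, K ≠ ∞ ∧ r < 1 ∧ ∀ k : ℕ,
      binomExp x k (fun i j => (betaMeasure (α + i) (β + j) (Ioi z))⁻¹) ≤ 1 + K * r ^ k := by
  rcases lt_or_ge z 0 with hz | hz
  · refine ⟨0, 0, by simp, by simp, fun k => ?_⟩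
    rw [zero_mul, add_zero, ← binomExp_one hx0 hx1 k]
    refine Finset.sum_le_sum fun p _ => ?_
    have := isProbabilityMeasureBeta (α := α + p.1) (β := β + p.2) (by positivity) (by positivity)
    have h : betaMeasure (α + p.1) (β + p.2) (Ioi z) = 1 := by
      rw [← compl_Iic, prob_compl_eq_one_iff measurableSet_Iic, betaMeasure_Iic_eq_zero hz.le]
    simp [h]
  -- The order is `z < w < s < t < x`: data of frequency at least `w` are good, and the interval
  -- from `s` to `t` serves as reference for the rest.
  set w := z + (x - z) / 4 with hw
  set s := z + 2 * (x - z) / 4 with hs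
  set t := z + 3 * (x - z) / 4 with ht
  obtain ⟨K, r, hK, hr, hgood⟩ :=
    exists_betaMeasure_Iic_le (z := z) (w := w) hα hβ (by linarith) (by linarith)
  have hJ : betaMeasure α β (Ioo s t) ≠ 0 :=
    betaMeasure_Ioo_ne_zero hα hβ (by linarith) (by linarith) (by linarith)
  have hpr := isProbabilityMeasureBeta hα hβ
  have hD : 0 < (x - t) * (s - w) := mul_pos (by linarith) (by linarith)
  set r' := ENNReal.ofReal (Real.exp (-((x - t) * (s - w)))) with hr'
  refine ⟨K + (betaMeasure α β (Ioo s t))⁻¹, max r r',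
    ENNReal.add_ne_top.2 ⟨hK, ENNReal.inv_ne_top.2 hJ⟩,
    max_lt hr (ofReal_exp_neg_lt_one hD), fun k => ?_⟩
  -- Good data give the first summand. For bad data the inverse may be huge, but the likelihood at
  -- `x` is at most `r' ^ (i + j)` times a multiple of marginal likelihood times posterior mass
  -- above `z`, which cancels the inverse. The marginal likelihoods, weighted by binomial
  -- coefficients, then sum to one.
  have hterm : ∀ i j : ℕ, likelihood i j x * (betaMeasure (α + i) (β + j) (Ioi z))⁻¹ ≤
      likelihood i j x * (1 + K * r ^ (i + j)) + (betaMeasure α β (Ioo s t))⁻¹ * r' ^ (i + j) *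
        ∫⁻ y, likelihood i j y ∂betaMeasure α β := by
    intro i j
    have := isProbabilityMeasureBeta (α := α + i) (β := β + j) (by positivity) (by positivity)
    have hp0 : betaMeasure (α + i) (β + j) (Ioi z) ≠ 0 := by
      have := betaMeasure_Ioo_ne_zero (α := α + i) (β := β + j) (s := z) (t := 1)
        (by positivity) (by positivity) hz (by linarith) le_rfl
      exact fun h => this (measure_mono_null Ioo_subset_Ioi_self h)
    have hpt : betaMeasure (α + i) (β + j) (Ioi z) ≠ ∞ := measure_ne_top _ _
    rcases le_or_gt (w * (i + j)) i with hij | hij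
    · refine le_add_right ?_
      gcongr
      rw [ENNReal.inv_le_iff_le_mul (fun _ => hp0) (fun h => absurd h hpt), mul_comm, add_mul,
        one_mul, add_comm]
      calc 1 = betaMeasure (α + i) (β + j) (Iic z) + betaMeasure (α + i) (β + j) (Ioi z) := by
            rw [← compl_Iic, prob_add_prob_compl measurableSet_Iic]
        _ ≤ _ := by gcongr; exact hgood i j hij
    · refine le_add_left ?_
      have key := likelihood_mul_betaMeasure_le hα hβ i j (x := x) (J := Ioo s t)
        measurableSet_Ioo (r := r' ^ (i + j)) (by
          intro y hy hy01
          refine likelihood_le_exp_mul hx0 hx1 hy01.1 hy01.2 hD.le i j ?_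
          have h1 : x - t ≤ x - y := by linarith [hy.2]
          have h2 : (s - w) * (i + j) ≤ (i + j) * y - i := by
            have : (s : ℝ) * (i + j) ≤ y * (i + j) := by gcongr; exact hy.1.le
            nlinarith
          have h3 : 0 ≤ (s - w) * (i + j : ℝ) := mul_nonneg (by linarith) (by positivity)
          have := mul_le_mul h1 h2 h3 (by linarith)
          nlinarith)
      rw [← ENNReal.div_eq_inv_mul, ENNReal.mul_inv_le_iff hp0 hpt, ENNReal.div_eq_inv_mul,
        mul_assoc, mul_assoc, ← ENNReal.div_eq_inv_mul,
        ENNReal.le_div_iff_mul_le (Or.inl hJ) (Or.inl (measure_ne_top _ _))]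
      refine key.trans ?_
      gcongr
      exact fun y hy => lt_trans (by linarith) hy.1
  calc binomExp x k (fun i j => (betaMeasure (α + i) (β + j) (Ioi z))⁻¹)
      ≤ ∑ p ∈ Finset.HasAntidiagonal.antidiagonal k,
          ((1 + K * r ^ k) * ((k.choose p.1 : ℝ≥0∞) * likelihood p.1 p.2 x) +
            (betaMeasure α β (Ioo s t))⁻¹ * r' ^ k * ((k.choose p.1 : ℝ≥0∞) *
              ∫⁻ y, likelihood p.1 p.2 y ∂betaMeasure α β)) := by
        refine Finset.sum_le_sum fun p hp => ?_
        rw [Finset.HasAntidiagonal.mem_antidiagonal] at hp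
        calc _ ≤ (k.choose p.1 : ℝ≥0∞) * _ := mul_le_mul_right (hterm p.1 p.2) _
          _ = _ := by rw [hp]; ring
    _ = 1 + K * r ^ k + (betaMeasure α β (Ioo s t))⁻¹ * r' ^ k := by
        rw [Finset.sum_add_distrib, ← Finset.mul_sum, ← Finset.mul_sum,
          sum_choose_mul_likelihood hx0 hx1, sum_choose_mul_lintegral_likelihood hα hβ,
          mul_one, mul_one]
    _ ≤ _ := by
        rw [add_mul, add_assoc]
        gcongr
        · exact le_max_left _ _
        · exact le_max_right _ _

/-! ### Geometrically small errors -/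

lemma exists_prod_le_one_add_geometric {ι : Type*} (s : Finset ι) (g : ι → ℕ → ℝ≥0∞)
    (h : ∀ v ∈ s, ∃ K r : ℝ≥0∞, K ≠ ∞ ∧ r < 1 ∧ ∀ k, g v k ≤ 1 + K * r ^ k) :
    ∃ K r : ℝ≥0∞, K ≠ ∞ ∧ r < 1 ∧ ∀ k, ∏ v ∈ s, g v k ≤ 1 + K * r ^ k := by
  classical
  induction s using Finset.induction_on with
  | empty => exact ⟨0, 0, by simp, by simp, by simp⟩
  | insert v s hv ih =>
    obtain ⟨K₁, r₁, hK₁, hr₁, h₁⟩ := h v (Finset.mem_insert_self v s)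
    obtain ⟨K₂, r₂, hK₂, hr₂, h₂⟩ := ih fun u hu => h u (Finset.mem_insert_of_mem hu)
    refine ⟨K₁ + K₂ + K₁ * K₂, max r₁ r₂, ?_, max_lt hr₁ hr₂, fun k => ?_⟩
    · finiteness
    rw [Finset.prod_insert hv]
    have hm : max r₁ r₂ ^ k ≤ 1 := pow_le_one₀ zero_le (max_lt hr₁ hr₂).le
    calc g v k * ∏ u ∈ s, g u k ≤ (1 + K₁ * r₁ ^ k) * (1 + K₂ * r₂ ^ k) :=
          mul_le_mul' (h₁ k) (h₂ k)
      _ ≤ (1 + K₁ * max r₁ r₂ ^ k) * (1 + K₂ * max r₁ r₂ ^ k) := by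
          gcongr
          · exact le_max_left _ _
          · exact le_max_right _ _
      -- In the cross term one of the two powers is bounded by one.
      _ = 1 + (K₁ + K₂) * max r₁ r₂ ^ k + K₁ * K₂ * (max r₁ r₂ ^ k * max r₁ r₂ ^ k) := by ring
      _ ≤ 1 + (K₁ + K₂) * max r₁ r₂ ^ k + K₁ * K₂ * (1 * max r₁ r₂ ^ k) := by gcongr
      _ = _ := by ring

lemma exists_forall_geometric {ι : Type*} [Fintype ι] {Q : ι → (ℕ → ℝ≥0∞) → Prop}
    (hQ : ∀ v f g, Q v f → f ≤ g → Q v g)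
    (h : ∀ v, ∃ K r : ℝ≥0∞, K ≠ ∞ ∧ r < 1 ∧ Q v (fun k => K * r ^ k)) :
    ∃ K r : ℝ≥0∞, K ≠ ∞ ∧ r < 1 ∧ ∀ v, Q v (fun k => K * r ^ k) := by
  choose K r hK hr h using h
  refine ⟨∑ v, K v, Finset.univ.sup r, by simp [hK], (Finset.sup_lt_iff (by simp)).2
    fun v _ => hr v, fun v => hQ v _ _ (h v) fun k => ?_⟩
  gcongr
  · exact Finset.single_le_sum (f := K) (fun _ _ => zero_le) (Finset.mem_univ v)
  · exact Finset.le_sup (Finset.mem_univ v)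

end Posting

namespace Posting

open MeasureTheory ProbabilityTheory
open scoped ENNReal

/-! ### Feedback given to a single topic -/

/-- Pascal's rule, that is, conditioning on one trial. -/
lemma binomExp_succ {x : ℝ} (hx0 : 0 ≤ x) (hx1 : x ≤ 1) (k : ℕ) (g : ℕ → ℕ → ℝ≥0∞) :
    binomExp x (k + 1) g = ENNReal.ofReal x * binomExp x k (fun i j => g (i + 1) j) +
      ENNReal.ofReal (1 - x) * binomExp x k (fun i j => g i (j + 1)) := by
  have h1 : 0 ≤ 1 - x := by linarith
  rw [binomExp, Finset.sum_antidiagonal_choose_succ_mul (fun i j => likelihood i j x * g i j),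
    add_comm, binomExp, binomExp, Finset.mul_sum, Finset.mul_sum]
  congr 1
  · refine Finset.sum_congr rfl fun p hp => ?_
    rw [Finset.HasAntidiagonal.mem_antidiagonal] at hp
    rw [← Nat.choose_symm_of_eq_add (show k = p.1 + p.2 from hp.symm), likelihood,
      show x ^ (p.1 + 1) * (1 - x) ^ p.2 = x * (x ^ p.1 * (1 - x) ^ p.2) by ring,
      ENNReal.ofReal_mul hx0, likelihood]
    ring
  · refine Finset.sum_congr rfl fun p _ => ?_
    rw [likelihood,
      show x ^ p.1 * (1 - x) ^ (p.2 + 1) = (1 - x) * (x ^ p.1 * (1 - x) ^ p.2) by ring,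
      ENNReal.ofReal_mul h1, likelihood]
    ring

variable {C N : Type*} [Fintype N]

lemma lintegral_feedbackLaw_prod (q : C → N → unitInterval) (c : C) (h : N → Bool → ℝ≥0∞) :
    ∫⁻ l, ∏ v, h v (l v) ∂feedbackLaw q c =
      ∏ v, (ENNReal.ofReal (q c v) * h v true + ENNReal.ofReal (1 - q c v) * h v false) := by
  classical
  rw [lintegral_fintype]
  simp_rw [feedbackLaw, Measure.pi_singleton, ← Finset.prod_mul_distrib]
  rw [← Fintype.prod_sum (fun v b => h v b * bernoulliMeasure true false (q c v) {b})]
  refine Finset.prod_congr rfl fun v _ => ?_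
  have h1 : ENNReal.ofReal (q c v) = (unitInterval.toNNReal (q c v) : ℝ≥0∞) := by
    rw [ENNReal.ofReal, Real.toNNReal_of_nonneg (q c v).2.1]; rfl
  have h2 : ENNReal.ofReal (1 - q c v) = (unitInterval.toNNReal (unitInterval.symm (q c v)) : ℝ≥0∞) := by
    rw [← unitInterval.coe_symm_eq, ENNReal.ofReal,
      Real.toNNReal_of_nonneg (unitInterval.symm (q c v)).2.1]; rfl
  rw [h1, h2, Fintype.sum_bool, bernoulliMeasure_apply _ (by simp),
    bernoulliMeasure_apply _ (by simp)]
  simp [mul_comm]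

instance (q : C → N → unitInterval) (c : C) : IsProbabilityMeasure (feedbackLaw q c) := by
  unfold feedbackLaw; infer_instance

/-- The numbers of positive and negative feedbacks of all followers after one more story. -/
def addFeedback (m : N → ℕ × ℕ) (l : N → Bool) (v : N) : ℕ × ℕ :=
  if l v = true then ((m v).1 + 1, (m v).2) else ((m v).1, (m v).2 + 1)

/-- The expectation of `g` for the feedback counts after `i` further stories of topic `c`, starting
from the counts `m`. -/
noncomputable def feedbackExp (q : C → N → unitInterval) (c : C) (g : (N → ℕ × ℕ) → ℝ≥0∞) :
    ℕ → (N → ℕ × ℕ) → ℝ≥0∞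
  | 0, m => g m
  | i + 1, m => ∫⁻ l, feedbackExp q c g i (addFeedback m l) ∂feedbackLaw q c

/-- Independence of the followers reduces product functionals to one binomial variable per follower.
-/
lemma feedbackExp_prod (q : C → N → unitInterval) (c : C) (g : N → ℕ → ℕ → ℝ≥0∞) (i : ℕ)
    (m : N → ℕ × ℕ) :
    feedbackExp q c (fun m => ∏ v, g v (m v).1 (m v).2) i m =
      ∏ v, binomExp (q c v) i (fun s t => g v ((m v).1 + s) ((m v).2 + t)) := by
  induction i generalizing m with
  | zero => simp [feedbackExp, binomExp, likelihood]
  | succ i ih =>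
    simp_rw [feedbackExp, ih, addFeedback]
    rw [lintegral_feedbackLaw_prod q c (fun v b => binomExp (q c v) i (fun s t =>
      g v ((if b = true then ((m v).1 + 1, (m v).2) else ((m v).1, (m v).2 + 1)).1 + s)
        ((if b = true then ((m v).1 + 1, (m v).2) else ((m v).1, (m v).2 + 1)).2 + t)))]
    refine Finset.prod_congr rfl fun v _ => ?_
    rw [binomExp_succ (q c v).2.1 (q c v).2.2]
    simp [add_right_comm, add_assoc]

lemma feedbackExp_add (q : C → N → unitInterval) (c : C) (g h : (N → ℕ × ℕ) → ℝ≥0∞)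
    (i : ℕ) (m : N → ℕ × ℕ) :
    feedbackExp q c (fun m => g m + h m) i m = feedbackExp q c g i m + feedbackExp q c h i m := by
  induction i generalizing m with
  | zero => rfl
  | succ i ih =>
    simp_rw [feedbackExp, ih]
    exact lintegral_add_left (measurable_of_finite _) _

lemma feedbackExp_const (q : C → N → unitInterval) (c : C) (y : ℝ≥0∞)
    (i : ℕ) (m : N → ℕ × ℕ) : feedbackExp q c (fun _ => y) i m = y := by
  induction i generalizing m with
  | zero => rfl
  | succ i ih => simp [feedbackExp, ih]

lemma feedbackExp_sum {ι : Type*} (q : C → N → unitInterval) (c : C) (s : Finset ι)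
    (g : ι → (N → ℕ × ℕ) → ℝ≥0∞) (i : ℕ) (m : N → ℕ × ℕ) :
    feedbackExp q c (fun m => ∑ u ∈ s, g u m) i m = ∑ u ∈ s, feedbackExp q c (g u) i m := by
  classical
  induction s using Finset.induction_on with
  | empty => simp [feedbackExp_const]
  | insert u s hu ih =>
    simp_rw [Finset.sum_insert hu]
    rw [feedbackExp_add, ih]

lemma feedbackExp_single (q : C → N → unitInterval) (c : C) (u : N) (g : ℕ → ℕ → ℝ≥0∞)
    (i : ℕ) : feedbackExp q c (fun m => g (m u).1 (m u).2) i (fun _ => (0, 0)) =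
      binomExp (q c u) i g := by
  classical
  have h := feedbackExp_prod q c (fun v => if v = u then g else fun _ _ => 1) i fun _ => (0, 0)
  have h1 : (fun m : N → ℕ × ℕ => ∏ v, (if v = u then g else fun _ _ => 1) (m v).1 (m v).2) =
      fun m => g (m u).1 (m u).2 := by
    funext m
    rw [Finset.prod_eq_single u (by intro v _ hv; simp [hv]) (by simp)]
    simp
  rw [h1] at h
  rw [h, Finset.prod_eq_single u]
  · simp
  · intro v _ hv
    simp only [hv, if_false]
    exact binomExp_one (q c v).2.1 (q c v).2.2 i
  · simp

/-! ### Histories -/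

section History

variable [DecidableEq C]

/-- Number of stories of topic `c`. -/
def playCount {t : ℕ} (H : History C N t) (c : C) : ℕ :=
  (Finset.univ.filter fun s : Fin t => (H s).1 = c).card

/-- The feedback counts of topic `c`. -/
def counts {t : ℕ} (H : History C N t) (c : C) (v : N) : ℕ × ℕ :=
  (posCount H c v, negCount H c v)

omit [Fintype N] in
lemma posCount_add_negCount {t : ℕ} (H : History C N t) (c : C) (v : N) :
    posCount H c v + negCount H c v = playCount H c := by
  rw [posCount, negCount, playCount, ← Finset.card_union_of_disjoint]
  · congr 1
    ext s
    cases h : (H s).2 v <;> simp [h]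
  · rw [Finset.disjoint_filter]
    intro s _ h1 h2
    simp [h1.2] at h2

omit [Fintype N] [DecidableEq C] in
lemma card_filter_snoc {t : ℕ} (H : History C N t) (y : Round C N) (P : Round C N → Prop)
    [DecidablePred P] :
    (Finset.univ.filter fun s : Fin (t + 1) => P ((Fin.snoc H y : History C N (t + 1)) s)).card =
      (Finset.univ.filter fun s : Fin t => P (H s)).card + if P y then 1 else 0 := by
  simp only [Finset.card_filter]
  rw [Fin.sum_univ_castSucc]
  simp

omit [Fintype N] in
lemma playCount_snoc {t : ℕ} (H : History C N t) (c c' : C) (l : N → Bool) :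
    playCount (Fin.snoc H (c', l) : History C N (t + 1)) c =
      if c' = c then playCount H c + 1 else playCount H c := by
  unfold playCount
  rw [card_filter_snoc H (c', l) (fun y => y.1 = c)]
  split_ifs <;> rfl

omit [Fintype N] in
lemma counts_snoc {t : ℕ} (H : History C N t) (c c' : C) (l : N → Bool) :
    counts (Fin.snoc H (c', l) : History C N (t + 1)) c =
      if c' = c then addFeedback (counts H c) l else counts H c := by
  funext v
  unfold counts posCount negCount
  rw [card_filter_snoc H (c', l) (fun y => y.1 = c ∧ y.2 v = true),
    card_filter_snoc H (c', l) (fun y => y.1 = c ∧ y.2 v = false)]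
  by_cases hc : c' = c
  · cases hl : l v <;> simp [hc, hl, addFeedback]
  · simp [hc]

end History

variable [Fintype C] [MeasurableSpace C] [MeasurableSingletonClass C]

lemma lintegral_historyLaw_succ (q : C → N → unitInterval) (p : Strategy C N) (t : ℕ)
    (g : History C N (t + 1) → ℝ≥0∞) :
    ∫⁻ H, g H ∂historyLaw q p (t + 1) =
      ∫⁻ H, ∫⁻ c, ∫⁻ l, g (Fin.snoc H (c, l)) ∂feedbackLaw q c ∂p t H ∂historyLaw q p t := by
  rw [historyLaw, Measure.lintegral_bind (measurable_of_finite _).aemeasurable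
    (measurable_of_finite _).aemeasurable]
  refine lintegral_congr fun H => ?_
  rw [Measure.lintegral_bind (measurable_of_finite _).aemeasurable
    (measurable_of_finite _).aemeasurable]
  refine lintegral_congr fun c => ?_
  rw [lintegral_map (measurable_of_finite _) (measurable_of_finite _)]

lemma isProbabilityMeasure_historyLaw (q : C → N → unitInterval) {p : Strategy C N}
    (hp : ∀ t H, IsProbabilityMeasure (p t H)) (t : ℕ) :
    IsProbabilityMeasure (historyLaw q p t) := by
  induction t with
  | zero => unfold historyLaw; infer_instance
  | succ t ih =>
    refine ⟨?_⟩
    rw [← lintegral_one, lintegral_historyLaw_succ]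
    simp

variable [DecidableEq C]

/-- A bound for the expected value of `f` summed over the plays of topic `c`, in terms of
independent rounds of feedback to stories of this topic, for an arbitrary strategy. -/
theorem sum_lintegral_plays_le (q : C → N → unitInterval) {p : Strategy C N}
    (hp : ∀ t H, IsProbabilityMeasure (p t H)) (c : C) (f : ℕ → (N → ℕ × ℕ) → ℝ≥0∞) (T : ℕ) :
    ∑ t ∈ Finset.range T,
        ∫⁻ H, p t H {c} * f (playCount H c) (counts H c) ∂historyLaw q p t ≤
      ∑ i ∈ Finset.range T, feedbackExp q c (f i) i (fun _ => (0, 0)) := by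
  -- A potential: the expected total of `f` if the next `n` stories all had topic `c`, starting with
  -- `k` plays and counts `m`.
  let W : ℕ → ℕ → (N → ℕ × ℕ) → ℝ≥0∞ := fun n k m =>
    ∑ i ∈ Finset.range n, feedbackExp q c (f (k + i)) i m
  have hW : ∀ n k m,
      W (n + 1) k m = f k m + ∫⁻ l, W n (k + 1) (addFeedback m l) ∂feedbackLaw q c := by
    intro n k m
    simp only [W]
    rw [Finset.sum_range_succ', lintegral_finsetSum _ (fun _ _ => measurable_of_finite _), add_comm]
    congr 1
    refine Finset.sum_congr rfl fun i _ => ?_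
    rw [feedbackExp, show k + (i + 1) = k + 1 + i by ring]
  have hWmono : ∀ n k m, W n k m ≤ W (n + 1) k m := fun n k m => by
    simp only [W]; rw [Finset.sum_range_succ]; exact le_self_add
  -- A supermartingale step: a play of `c` pays `f` out of the potential exactly, by `hW`; any other
  -- topic leaves the state alone and only wastes one unit of budget.
  have hstep : ∀ t n,
      ∫⁻ H, p t H {c} * f (playCount H c) (counts H c) ∂historyLaw q p t +
        ∫⁻ H, W n (playCount H c) (counts H c) ∂historyLaw q p (t + 1) ≤
      ∫⁻ H, W (n + 1) (playCount H c) (counts H c) ∂historyLaw q p t := by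
    intro t n
    rw [lintegral_historyLaw_succ, ← lintegral_add_left (measurable_of_finite _)]
    refine lintegral_mono fun H => ?_
    have h1 : p t H {c} * f (playCount H c) (counts H c) =
        ∫⁻ c', ({c} : Set C).indicator (fun _ => f (playCount H c) (counts H c)) c' ∂p t H := by
      rw [lintegral_indicator_const (measurableSet_singleton c), mul_comm]
    dsimp only
    rw [h1, ← lintegral_add_left (measurable_of_finite _)]
    have := hp t H
    calc _ ≤ ∫⁻ c', W (n + 1) (playCount H c) (counts H c) ∂p t H := by
          refine lintegral_mono fun c' => ?_
          simp only [playCount_snoc, counts_snoc]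
          by_cases hc : c' = c
          · subst hc
            simp [hW]
          · simpa [hc] using hWmono n _ _
      _ = _ := by simp
  have hmain : ∀ T n,
      ∑ t ∈ Finset.range T,
          ∫⁻ H, p t H {c} * f (playCount H c) (counts H c) ∂historyLaw q p t +
        ∫⁻ H, W n (playCount H c) (counts H c) ∂historyLaw q p T ≤ W (T + n) 0 fun _ => (0, 0) := by
    intro T
    induction T with
    | zero =>
      intro n
      rw [historyLaw, lintegral_dirac' _ (measurable_of_finite _)]
      have h1 : playCount (Fin.elim0 : History C N 0) c = 0 := by simp [playCount]
      have h2 : counts (Fin.elim0 : History C N 0) c = fun _ => (0, 0) := by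
        funext v; simp [counts, posCount, negCount]
      simp [h1, h2]
    | succ T ih =>
      intro n
      rw [Finset.sum_range_succ, add_assoc, show T + 1 + n = T + (n + 1) by ring]
      exact (add_le_add_right (hstep T n) _).trans (ih (n + 1))
  have := hmain T 0
  simp only [W] at this
  simpa using this

end Posting

namespace Posting

open MeasureTheory ProbabilityTheory
open scoped ENNReal

/-! ### One step of posterior sampling -/

/-- Among independently sampled scores, a topic whose sampled score is at most `y` is selected
with a probability that is controlled by the one of selecting the topic `d`. -/
lemma measure_selected_le_mul_inv_sub_one {C Ω : Type*} [Fintype C] [MeasurableSpace C]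
    [MeasurableSingletonClass C] [MeasurableSpace Ω] (ρ : C → Measure Ω)
    [∀ c, IsProbabilityMeasure (ρ c)] (S : C → Ω → ℝ) (hS : ∀ c, Measurable (S c))
    {sel : (C → ℝ) → C} (hsel : IsArgmaxRule sel) (c d : C) (y : ℝ)
    (hp : ρ d {ω | y < S d ω} ≠ 0) :
    Measure.pi ρ {w | sel (fun j => S j (w j)) = c ∧ S c (w c) ≤ y} ≤
      Measure.pi ρ {w | sel (fun j => S j (w j)) = d} * ((ρ d {ω | y < S d ω})⁻¹ - 1) := by
  classical
  set p := ρ d {ω | y < S d ω} with hpdef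
  set R := ∏ j ∈ Finset.univ.erase d, ρ j {ω | S j ω ≤ y} with hR
  have hcompl : ρ d {ω | S d ω ≤ y} = 1 - p := by
    rw [hpdef, ← prob_compl_eq_one_sub (measurableSet_lt measurable_const (hS d))]
    congr 1
    ext ω
    simp
  -- If the winner scores at most `y`, so does every topic.
  have h1 : Measure.pi ρ {w | sel (fun j => S j (w j)) = c ∧ S c (w c) ≤ y} ≤ (1 - p) * R := by
    rw [← hcompl, hR, Finset.mul_prod_erase _ (fun j => ρ j {ω | S j ω ≤ y}) (Finset.mem_univ d),
      ← Measure.pi_pi]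
    refine measure_mono fun w hw j _ => ?_
    have := hsel.2 (fun j => S j (w j)) j
    rw [hw.1] at this
    exact this.trans hw.2
  -- If only `d` exceeds `y`, then `d` wins regardless of the tie-breaking rule.
  have h2 : p * R ≤ Measure.pi ρ {w | sel (fun j => S j (w j)) = d} := by
    have : p * R = Measure.pi ρ (Set.univ.pi fun j =>
        if j = d then {ω | y < S j ω} else {ω | S j ω ≤ y}) := by
      rw [Measure.pi_pi, ← Finset.mul_prod_erase _ _ (Finset.mem_univ d), if_pos rfl]
      congr 1
      refine Finset.prod_congr rfl fun j hj => ?_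
      rw [if_neg (Finset.ne_of_mem_erase hj)]
    rw [this]
    refine measure_mono fun w hw => ?_
    by_contra hne
    have hne' : sel (fun j => S j (w j)) ≠ d := hne
    have hd : y < S d (w d) := by simpa using hw d trivial
    have hs := hw (sel fun j => S j (w j)) trivial
    simp only [if_neg hne', Set.mem_ofPred_eq] at hs
    exact absurd ((hsel.2 (fun j => S j (w j)) d).trans hs) (not_le.2 hd)
  have hpt : p ≠ ∞ := measure_ne_top _ _
  calc _ ≤ (1 - p) * R := h1
    _ = (p * R) * (p⁻¹ - 1) := by
      rw [mul_right_comm, ENNReal.mul_sub (fun _ _ => hpt), ENNReal.mul_inv_cancel hp hpt, mul_one]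
    _ ≤ _ := mul_le_mul_left h2 _

lemma betaMeasure_Ioi_ne_zero {α β z : ℝ} (hα : 0 < α) (hβ : 0 < β) (hz : z < 1) :
    betaMeasure α β (Set.Ioi z) ≠ 0 := fun h =>
  betaMeasure_Ioo_ne_zero (s := max z 0) (t := 1) hα hβ (le_max_right _ _)
    (max_lt hz one_pos) le_rfl
    (measure_mono_null (fun _ hx => (le_max_left _ _).trans_lt hx.1) h)

variable {C N : Type*} [Fintype N]

/-- With half of the margin per follower, summing weak inequalities still gives a strict one. -/
lemma lt_sum_mul_add {a : N → ℝ} {au : ℝ} (ha : ∀ v, 0 ≤ a v) (hau : 0 ≤ au)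
    (hsum : ∑ v, a v + au = 1) (q w : N → ℝ) {ε : ℝ} (hε : 0 < ε) (b : ℝ)
    (h : ∀ v, q v - ε / 2 < w v) : ∑ v, a v * q v + b - ε < ∑ v, a v * w v + b := by
  have h1 : ∑ v, a v * (q v - ε / 2) ≤ ∑ v, a v * w v :=
    Finset.sum_le_sum fun v _ => mul_le_mul_of_nonneg_left (h v).le (ha v)
  simp_rw [mul_sub] at h1
  rw [Finset.sum_sub_distrib, ← Finset.sum_mul] at h1
  nlinarith

lemma exists_lt_of_lt_sum_mul {a : N → ℝ} {au : ℝ} (ha : ∀ v, 0 ≤ a v) (hau : 0 ≤ au)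
    (hsum : ∑ v, a v + au = 1) (q w : N → ℝ) {ε : ℝ} (hε : 0 < ε) (b : ℝ)
    (h : ∑ v, a v * q v + b + ε < ∑ v, a v * w v + b) : ∃ v, q v + ε < w v := by
  by_contra! hle
  have h1 : ∑ v, a v * w v ≤ ∑ v, a v * (q v + ε) :=
    Finset.sum_le_sum fun v _ => mul_le_mul_of_nonneg_left (hle v) (ha v)
  simp_rw [mul_add] at h1
  rw [Finset.sum_add_distrib, ← Finset.sum_mul] at h1
  nlinarith

variable [Fintype C] [DecidableEq C] [MeasurableSpace C] [MeasurableSingletonClass C]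

/-- The law of the estimates for the topic `c` under posterior sampling. -/
noncomputable def topicPosterior (α β : ℝ) (m : N → ℕ × ℕ) : Measure (N → ℝ) :=
  Measure.pi fun v => betaMeasure (α + (m v).1) (β + (m v).2)

lemma isProbabilityMeasure_topicPosterior {α β : ℝ} (hα : 0 < α) (hβ : 0 < β) (m : N → ℕ × ℕ) :
    IsProbabilityMeasure (topicPosterior α β m) := by
  have : ∀ v, IsProbabilityMeasure (betaMeasure (α + (m v).1) (β + (m v).2)) :=
    fun v => isProbabilityMeasureBeta (by positivity) (by positivity)
  unfold topicPosterior
  infer_instance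

omit [MeasurableSpace C] [MeasurableSingletonClass C] in
lemma betaPosterior_eq (α β : ℝ) {t : ℕ} (H : History C N t) :
    betaPosterior α β H = Measure.pi fun c => topicPosterior α β (counts H c) := rfl

lemma measurable_sum_mul_add (a : N → ℝ) (b : ℝ) :
    Measurable fun w : N → ℝ => ∑ v, a v * w v + b := by fun_prop

lemma posteriorSampling_apply {sel : (C → ℝ) → C} (hsel : IsArgmaxRule sel) (a : N → ℝ) (au : ℝ)
    (x : C → ℝ) (α β : ℝ) {t : ℕ} (H : History C N t) (c : C) :
    posteriorSampling sel a au x α β t H {c} =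
      Measure.pi (fun c => topicPosterior α β (counts H c))
        {w | sel (fun j => ∑ v, a v * w j v + au * x j) = c} := by
  have hm : Measurable fun w : C → N → ℝ => sel (score a au x w) :=
    hsel.1.comp (measurable_pi_lambda _ fun c => by unfold score; fun_prop)
  rw [posteriorSampling, Measure.map_apply hm (measurableSet_singleton c), betaPosterior_eq]
  rfl

omit [MeasurableSingletonClass C] in
lemma isProbabilityMeasure_posteriorSampling {sel : (C → ℝ) → C} (hsel : IsArgmaxRule sel)
    (a : N → ℝ) (au : ℝ) (x : C → ℝ) {α β : ℝ} (hα : 0 < α) (hβ : 0 < β) (t : ℕ)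
    (H : History C N t) : IsProbabilityMeasure (posteriorSampling sel a au x α β t H) := by
  have hm : Measurable fun w : C → N → ℝ => sel (score a au x w) :=
    hsel.1.comp (measurable_pi_lambda _ fun c => by unfold score; fun_prop)
  have := fun c => isProbabilityMeasure_topicPosterior hα hβ (counts H c)
  have : IsProbabilityMeasure (betaPosterior α β H) := by
    rw [betaPosterior_eq]; infer_instance
  exact Measure.isProbabilityMeasure_map hm.aemeasurable

/-- A bound for the probability of choosing `c` by the failure of the estimates for `d` to be
large, and the failure of the estimates for `c` to be small. -/
lemma posteriorSampling_singleton_le {a : N → ℝ} {au : ℝ} {x : C → ℝ} {q : C → N → unitInterval}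
    (ha : ∀ v, 0 ≤ a v) (hau : 0 ≤ au) (hsum : ∑ v, a v + au = 1)
    {α β : ℝ} (hα : 0 < α) (hβ : 0 < β) {sel : (C → ℝ) → C} (hsel : IsArgmaxRule sel) {c d : C}
    {ε : ℝ} (hε : 0 < ε) (hgap : score a au x (fun c v => (q c v : ℝ)) c + 2 * ε ≤
      score a au x (fun c v => (q c v : ℝ)) d) {t : ℕ} (H : History C N t) :
    posteriorSampling sel a au x α β t H {c} ≤
      posteriorSampling sel a au x α β t H {d} *
        (∏ v, (betaMeasure (α + (counts H d v).1) (β + (counts H d v).2)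
          (Set.Ioi (q d v - ε / 2)))⁻¹ - 1) +
      ∑ v, betaMeasure (α + (counts H c v).1) (β + (counts H c v).2) (Set.Ioi (q c v + ε)) := by
  have hprob := fun c => isProbabilityMeasure_topicPosterior hα hβ (counts H c)
  have hbeta : ∀ c v, IsProbabilityMeasure
      (betaMeasure (α + (counts H c v).1) (β + (counts H c v).2)) :=
    fun c v => isProbabilityMeasureBeta (by positivity) (by positivity)
  set ρ := fun c => topicPosterior α β (counts H c) with hρ
  set S : C → (N → ℝ) → ℝ := fun j w => ∑ v, a v * w v + au * x j with hSdef
  have hS : ∀ j, Measurable (S j) := fun j => measurable_sum_mul_add a _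
  -- By the gap, `y` is `ε` below the true score of `d` and at least `ε` above that of `c`.
  set y := score a au x (fun c v => (q c v : ℝ)) d - ε with hy
  have hprod : ∏ v, betaMeasure (α + (counts H d v).1) (β + (counts H d v).2)
      (Set.Ioi (q d v - ε / 2)) ≤ ρ d {ω | y < S d ω} := by
    rw [← Measure.pi_pi]
    refine measure_mono fun w hw => ?_
    exact lt_sum_mul_add ha hau hsum (fun v => (q d v : ℝ)) w hε _ fun v => hw v trivial
  have hp0 : ∏ v, betaMeasure (α + (counts H d v).1) (β + (counts H d v).2)
      (Set.Ioi (q d v - ε / 2)) ≠ 0 := by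
    refine Finset.prod_ne_zero_iff.2 fun v _ => betaMeasure_Ioi_ne_zero (by positivity)
      (by positivity) ?_
    have := (q d v).2.2
    linarith
  have hpos : ρ d {ω | y < S d ω} ≠ 0 := fun h => hp0 (le_zero_iff.1 (h ▸ hprod))
  rw [posteriorSampling_apply hsel, posteriorSampling_apply hsel]
  calc Measure.pi ρ {w | sel (fun j => S j (w j)) = c}
      ≤ Measure.pi ρ ({w | sel (fun j => S j (w j)) = c ∧ S c (w c) ≤ y} ∪
          ⋃ v, (fun w : C → N → ℝ => w c) ⁻¹' ((fun w : N → ℝ => w v) ⁻¹' Set.Ioi (q c v + ε))) := by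
        refine measure_mono fun w hw => ?_
        rcases le_or_gt (S c (w c)) y with h | h
        · exact Or.inl ⟨hw, h⟩
        · refine Or.inr (Set.mem_iUnion.2 ?_)
          refine exists_lt_of_lt_sum_mul ha hau hsum (fun v => (q c v : ℝ)) (w c) hε (au * x c) ?_
          refine lt_of_le_of_lt ?_ h
          simp only [score] at hgap hy
          linarith
    _ ≤ _ := by
        refine (measure_union_le _ _).trans (add_le_add ?_ ?_)
        · refine (measure_selected_le_mul_inv_sub_one ρ S hS hsel c d y hpos).trans ?_
          refine mul_le_mul_right (tsub_le_tsub_right ?_ 1) _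
          rw [← ENNReal.prod_inv_distrib]
          · exact ENNReal.inv_le_inv.2 hprod
          · intro u _ v _ _
            exact Or.inr (measure_ne_top _ _)
        · refine (measure_iUnion_fintype_le _ _).trans (Finset.sum_le_sum fun v _ => le_of_eq ?_)
          rw [(measurePreserving_eval ρ c).measure_preimage
              ((measurable_pi_apply v) measurableSet_Ioi).nullMeasurableSet, hρ]
          dsimp only [topicPosterior]
          rw [(measurePreserving_eval _ v).measure_preimage measurableSet_Ioi.nullMeasurableSet]

end Posting

namespace Posting

open MeasureTheory ProbabilityTheory
open scoped ENNReal

/-! ### Number of plays of a suboptimal topic -/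

lemma sum_range_mul_pow_le (K r : ℝ≥0∞) (T : ℕ) :
    ∑ i ∈ Finset.range T, K * r ^ i ≤ K * (1 - r)⁻¹ := by
  rw [← Finset.mul_sum, ← ENNReal.tsum_geometric]
  exact mul_le_mul_right (ENNReal.sum_le_tsum _) _

lemma inv_one_sub_ne_top {r : ℝ≥0∞} (hr : r < 1) : (1 - r)⁻¹ ≠ ∞ :=
  ENNReal.inv_ne_top.2 (tsub_pos_of_lt hr).ne'

variable {C N : Type*} [Fintype N]

lemma exists_feedbackExp_inv_betaMeasure_le (q : C → N → unitInterval) (c : C) {α β ε : ℝ}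
    (hα : 0 < α) (hβ : 0 < β) (hε : 0 < ε) :
    ∃ K r : ℝ≥0∞, K ≠ ∞ ∧ r < 1 ∧ ∀ i, feedbackExp q c (fun m =>
      ∏ v, (betaMeasure (α + (m v).1) (β + (m v).2) (Set.Ioi (q c v - ε)))⁻¹ - 1) i
        (fun _ => (0, 0)) ≤ K * r ^ i := by
  obtain ⟨K, r, hK, hr, h⟩ := exists_prod_le_one_add_geometric (Finset.univ : Finset N)
    (fun v k => binomExp (q c v) k
      (fun i j => (betaMeasure (α + i) (β + j) (Set.Ioi (q c v - ε)))⁻¹))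
    (fun v _ => exists_binomExp_inv_betaMeasure_Ioi_le hα hβ (q c v).2.2 (q c v).2.1 (by linarith))
  refine ⟨K, r, hK, hr, fun i => ?_⟩
  have h1 := h i
  have h2 := feedbackExp_prod q c
    (fun v i j => (betaMeasure (α + i) (β + j) (Set.Ioi (q c v - ε)))⁻¹) i fun _ => (0, 0)
  simp only [zero_add] at h2
  -- Each inverse probability is at least one, so the truncated subtraction loses nothing and the
  -- constant 1 cancels exactly.
  have h3 : (fun m : N → ℕ × ℕ =>
      ∏ v, (betaMeasure (α + (m v).1) (β + (m v).2) (Set.Ioi (q c v - ε)))⁻¹) =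
      fun m => 1 + (∏ v, (betaMeasure (α + (m v).1) (β + (m v).2)
        (Set.Ioi (q c v - ε)))⁻¹ - 1) := by
    funext m
    refine (add_tsub_cancel_of_le (Finset.one_le_prod' fun v _ => ?_)).symm
    have := isProbabilityMeasureBeta (α := α + (m v).1) (β := β + (m v).2)
      (by positivity) (by positivity)
    exact ENNReal.one_le_inv.2 prob_le_one
  rw [← h2, h3, feedbackExp_add, feedbackExp_const] at h1
  exact (ENNReal.add_le_add_iff_left ENNReal.one_ne_top).1 h1

lemma exists_betaMeasure_Ioi_le_forall (q : N → unitInterval) {α β ε : ℝ}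
    (hα : 0 < α) (hβ : 0 < β) (hε : 0 < ε) :
    ∃ K r : ℝ≥0∞, K ≠ ∞ ∧ r < 1 ∧ ∀ v, ∀ i j : ℕ, (i : ℝ) ≤ (q v + ε / 2) * (i + j) →
      betaMeasure (α + i) (β + j) (Set.Ioi (q v + ε)) ≤ K * r ^ (i + j) :=
  exists_forall_geometric (Q := fun v f => ∀ i j : ℕ, (i : ℝ) ≤ (q v + ε / 2) * (i + j) →
      betaMeasure (α + i) (β + j) (Set.Ioi (q v + ε)) ≤ f (i + j))
    (fun _ _ _ hf hfg i j hij => (hf i j hij).trans (hfg _))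
    fun v => exists_betaMeasure_Ioi_le hα hβ (by linarith) (by linarith [(q v).2.1])

lemma exists_sum_feedbackExp_indicator_le (q : C → N → unitInterval) (c : C) {ε : ℝ}
    (hε : 0 < ε) :
    ∃ K : ℝ≥0∞, K ≠ ∞ ∧ ∀ T, ∑ i ∈ Finset.range T, feedbackExp q c (fun m => ∑ v,
      if (q c v + ε) * ((m v).1 + (m v).2) < (m v).1 then (1 : ℝ≥0∞) else 0) i
        (fun _ => (0, 0)) ≤ K := by
  choose r hr h using fun v => exists_binomExp_indicator_le (x := q c v) (w := q c v + ε)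
    (q c v).2.1 (q c v).2.2 (by linarith)
  refine ⟨∑ v, 1 * (1 - r v)⁻¹, ?_, fun T => ?_⟩
  · simpa using fun v => (tsub_pos_of_lt (hr v)).ne'
  simp_rw [feedbackExp_sum]
  rw [Finset.sum_comm]
  refine Finset.sum_le_sum fun v _ => le_trans (Finset.sum_le_sum fun i _ => ?_)
    (sum_range_mul_pow_le 1 (r v) T)
  rw [feedbackExp_single q c v
    (fun s t => if ((q c v : ℝ) + ε) * (s + t) < s then (1 : ℝ≥0∞) else 0), one_mul]
  exact h v i

variable [Fintype C] [DecidableEq C] [MeasurableSpace C] [MeasurableSingletonClass C]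

/-- The cutoff `L` separates early plays of `c`, counted trivially, from late ones, where its
posterior is concentrated. It stays free so that it can later grow with `T`. -/
lemma exists_sum_lintegral_posteriorSampling_le {a : N → ℝ} {au : ℝ} {x : C → ℝ}
    {q : C → N → unitInterval}
    (ha : ∀ v, 0 ≤ a v) (hau : 0 ≤ au) (hsum : ∑ v, a v + au = 1)
    {α β : ℝ} (hα : 0 < α) (hβ : 0 < β) {sel : (C → ℝ) → C} (hsel : IsArgmaxRule sel) {c d : C}
    (hgap : score a au x (fun c v => (q c v : ℝ)) c < score a au x (fun c v => (q c v : ℝ)) d) :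
    ∃ K r : ℝ≥0∞, K ≠ ∞ ∧ r < 1 ∧ ∀ T L : ℕ,
      ∑ t ∈ Finset.range T, ∫⁻ H, posteriorSampling sel a au x α β t H {c}
        ∂historyLaw q (posteriorSampling sel a au x α β) t ≤ K + L + K * (T * r ^ L) := by
  set p := posteriorSampling (N := N) sel a au x α β with hpdef
  have hp : ∀ t H, IsProbabilityMeasure (p t H) := fun t H =>
    isProbabilityMeasure_posteriorSampling hsel a au x hα hβ t H
  have hhist := fun t => isProbabilityMeasure_historyLaw q hp t
  obtain ⟨ε, hε, hgap'⟩ : ∃ ε > 0, score a au x (fun c v => (q c v : ℝ)) c + 2 * ε ≤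
      score a au x (fun c v => (q c v : ℝ)) d :=
    ⟨(score a au x (fun c v => (q c v : ℝ)) d - score a au x (fun c v => (q c v : ℝ)) c) / 2,
      by linarith, by linarith⟩
  obtain ⟨K₁, r₁, hK₁, hr₁, h₁⟩ :=
    exists_feedbackExp_inv_betaMeasure_le q d hα hβ (half_pos hε)
  obtain ⟨K₂, r, hK₂, hr, h₂⟩ := exists_betaMeasure_Ioi_le_forall (q c) hα hβ hε
  obtain ⟨K₃, hK₃, h₃⟩ := exists_sum_feedbackExp_indicator_le q c (half_pos hε)
  set B : ℝ≥0∞ := Fintype.card N * K₂ with hB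
  set F : (N → ℕ × ℕ) → ℝ≥0∞ := fun m =>
    ∏ v, (betaMeasure (α + (m v).1) (β + (m v).2) (Set.Ioi (q d v - ε / 2)))⁻¹ - 1 with hF
  set G : ℕ → (N → ℕ × ℕ) → ℝ≥0∞ := fun _ m => ∑ v,
    if (q c v + ε / 2) * ((m v).1 + (m v).2) < (m v).1 then (1 : ℝ≥0∞) else 0 with hG
  refine ⟨K₁ * (1 - r₁)⁻¹ + K₃ + B, r, ?_, hr, fun T L => ?_⟩
  · have := inv_one_sub_ne_top hr₁
    finiteness
  have hstep : ∀ t (H : History C N t), p t H {c} ≤ p t H {d} * F (counts H d) +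
      p t H {c} * ((if playCount H c < L then 1 else 0) + G (playCount H c) (counts H c)) +
        B * r ^ L := by
    intro t H
    by_cases hgood : L ≤ playCount H c ∧ ∀ v, ((counts H c v).1 : ℝ) ≤
        (q c v + ε / 2) * ((counts H c v).1 + (counts H c v).2)
    · refine (posteriorSampling_singleton_le ha hau hsum hα hβ hsel hε hgap' H).trans
        (add_le_add le_self_add ?_)
      calc _ ≤ ∑ v : N, K₂ * r ^ L := by
            refine Finset.sum_le_sum fun v _ => (h₂ v _ _ (hgood.2 v)).trans ?_
            rw [show (counts H c v).1 + (counts H c v).2 = playCount H c from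
              posCount_add_negCount H c v]
            exact mul_le_mul_right (pow_le_pow_of_le_one zero_le hr.le hgood.1) _
        _ = _ := by simp [hB, mul_assoc]
    -- Too few plays or an excessive frequency makes the bracket at least one, so the middle term
    -- alone dominates.
    · refine le_add_right (le_add_left ?_)
      refine le_mul_of_one_le_right' ?_
      rw [not_and_or, not_le] at hgood
      rcases hgood with h | h
      · rw [if_pos h]; exact le_self_add
      · push Not at h
        obtain ⟨v, hv⟩ := h
        refine le_add_left ?_
        refine le_trans ?_ (Finset.single_le_sum (fun _ _ => zero_le) (Finset.mem_univ v))
        rw [if_pos hv]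
  -- Charged to the successive plays of `d`, these terms form a convergent geometric series.
  have hsumF : ∑ t ∈ Finset.range T, ∫⁻ H, p t H {d} * F (counts H d) ∂historyLaw q p t ≤
      K₁ * (1 - r₁)⁻¹ :=
    (sum_lintegral_plays_le q hp d (fun _ => F) T).trans
      ((Finset.sum_le_sum fun i _ => h₁ i).trans (sum_range_mul_pow_le _ _ _))
  have hsumG : ∑ t ∈ Finset.range T, ∫⁻ H, p t H {c} *
      ((if playCount H c < L then 1 else 0) + G (playCount H c) (counts H c)) ∂historyLaw q p t ≤
      L + K₃ := by
    refine (sum_lintegral_plays_le q hp c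
      (fun k m => (if k < L then 1 else 0) + G k m) T).trans ?_
    simp_rw [feedbackExp_add, feedbackExp_const]
    rw [Finset.sum_add_distrib]
    refine add_le_add ?_ (h₃ T)
    rw [← Finset.sum_filter, Finset.sum_const, nsmul_one]
    norm_cast
    refine (Finset.card_le_card (t := Finset.range L) fun i hi => ?_).trans
      (Finset.card_range L).le
    simpa using (Finset.mem_filter.1 hi).2
  calc ∑ t ∈ Finset.range T, ∫⁻ H, p t H {c} ∂historyLaw q p t
      ≤ ∑ t ∈ Finset.range T, (∫⁻ H, p t H {d} * F (counts H d) ∂historyLaw q p t +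
          ∫⁻ H, p t H {c} * ((if playCount H c < L then 1 else 0) +
            G (playCount H c) (counts H c)) ∂historyLaw q p t + B * r ^ L) := by
        refine Finset.sum_le_sum fun t _ => (lintegral_mono (hstep t)).trans_eq ?_
        rw [lintegral_add_left (measurable_of_finite _), lintegral_add_left (measurable_of_finite _),
          lintegral_const, measure_univ, mul_one]
    _ ≤ K₁ * (1 - r₁)⁻¹ + (L + K₃) + T * (B * r ^ L) := by
        rw [Finset.sum_add_distrib, Finset.sum_add_distrib, Finset.sum_const, nsmul_eq_mul,
          Finset.card_range]
        gcongr
    _ ≤ K₁ * (1 - r₁)⁻¹ + K₃ + B + L + (K₁ * (1 - r₁)⁻¹ + K₃ + B) * (T * r ^ L) := by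
        have h1 : T * (B * r ^ L) ≤ (K₁ * (1 - r₁)⁻¹ + K₃ + B) * (T * r ^ L) := by
          rw [mul_left_comm]
          gcongr
          exact le_add_self
        refine add_le_add ?_ h1
        rw [← add_assoc, add_right_comm]
        exact add_le_add_left le_self_add _

end Posting

namespace Posting

open MeasureTheory ProbabilityTheory Filter Asymptotics
open scoped ENNReal

/-! ### The regret as a sum over the plays of suboptimal topics -/

lemma integral_bind_of_finite {X Y : Type*} [Finite X] [Finite Y] [MeasurableSpace X]
    [MeasurableSpace Y] [MeasurableSingletonClass X] [MeasurableSingletonClass Y]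
    (m : Measure X) [IsFiniteMeasure m] (κ : X → Measure Y) [∀ y, IsProbabilityMeasure (κ y)]
    (f : Y → ℝ) : ∫ y, f y ∂m.bind κ = ∫ x, ∫ y, f y ∂κ x ∂m := by
  have := Fintype.ofFinite Y
  have hκ : AEMeasurable κ m := (measurable_of_finite κ).aemeasurable
  have : IsFiniteMeasure (m.bind κ) := ⟨by
    rw [Measure.bind_apply .univ hκ]; simp⟩
  rw [integral_fintype .of_finite]
  simp_rw [integral_fintype (μ := κ _) (f := f) .of_finite]
  rw [integral_finsetSum _ fun _ _ => .of_finite]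
  refine Finset.sum_congr rfl fun y _ => ?_
  simp_rw [smul_eq_mul]
  rw [integral_mul_const, measureReal_def, Measure.bind_apply (measurableSet_singleton y) hκ]
  simp_rw [measureReal_def]
  rw [integral_toReal (measurable_of_finite _).aemeasurable (by simp)]

variable {C N : Type*} [Fintype C] [MeasurableSpace C] [MeasurableSingletonClass C] [Fintype N]

lemma integral_historyLaw_succ (q : C → N → unitInterval) {p : Strategy C N}
    (hp : ∀ t H, IsProbabilityMeasure (p t H)) (t : ℕ) (g : History C N (t + 1) → ℝ) :
    ∫ H, g H ∂historyLaw q p (t + 1) =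
      ∫ H, ∫ c, ∫ l, g (Fin.snoc H (c, l)) ∂feedbackLaw q c ∂p t H ∂historyLaw q p t := by
  have := isProbabilityMeasure_historyLaw q hp t
  have hmap : ∀ (H : History C N t) (c : C), IsProbabilityMeasure
      ((feedbackLaw q c).map fun l => (Fin.snoc H (c, l) : History C N (t + 1))) :=
    fun H c => Measure.isProbabilityMeasure_map (measurable_of_finite _).aemeasurable
  have hbind : ∀ H : History C N t, IsProbabilityMeasure ((p t H).bind fun c =>
      (feedbackLaw q c).map fun l => (Fin.snoc H (c, l) : History C N (t + 1))) :=
    fun H => ⟨by rw [Measure.bind_apply .univ (measurable_of_finite _).aemeasurable]; simp⟩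
  rw [historyLaw, integral_bind_of_finite]
  refine integral_congr_ae (ae_of_all _ fun H => ?_)
  dsimp only
  rw [integral_bind_of_finite]
  refine integral_congr_ae (ae_of_all _ fun c => ?_)
  exact integral_map (measurable_of_finite _).aemeasurable
    (measurable_of_finite _).aestronglyMeasurable

omit [Fintype C] [MeasurableSpace C] [MeasurableSingletonClass C] in
lemma integral_reward_feedbackLaw (a : N → ℝ) (au : ℝ) (x : C → ℝ) (q : C → N → unitInterval)
    (c : C) :
    ∫ l, (∑ v, a v * (if l v = true then 1 else 0) + au * x c) ∂feedbackLaw q c =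
      score a au x (fun c v => (q c v : ℝ)) c := by
  rw [integral_add .of_finite .of_finite, integral_finsetSum _ fun _ _ => .of_finite, score]
  simp_rw [integral_const_mul]
  congr 1
  · refine Finset.sum_congr rfl fun v _ => ?_
    have h := integral_comp_eval (X := fun _ : N => Bool)
      (μ := fun v => bernoulliMeasure true false (q c v)) (i := v)
      (f := fun b : Bool => if b = true then (1 : ℝ) else 0)
      (measurable_of_finite _).aestronglyMeasurable
    rw [feedbackLaw, h, integral_bernoulliMeasure]
    simp
  · simp

lemma util_succ (a : N → ℝ) (au : ℝ) (x : C → ℝ) (q : C → N → unitInterval) {p : Strategy C N}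
    (hp : ∀ t H, IsProbabilityMeasure (p t H)) (T : ℕ) :
    util a au x q p (T + 1) = util a au x q p T +
      ∫ H, ∫ c, score a au x (fun c v => (q c v : ℝ)) c ∂p T H ∂historyLaw q p T := by
  have := isProbabilityMeasure_historyLaw q hp T
  rw [util, integral_historyLaw_succ q hp, util, ← integral_add .of_finite .of_finite]
  refine integral_congr_ae (ae_of_all _ fun H => ?_)
  dsimp only
  simp_rw [Fin.sum_univ_castSucc, Fin.snoc_castSucc, Fin.snoc_last]
  have := hp T H
  simp_rw [integral_add (μ := feedbackLaw q _) (f := fun _ => ∑ t : Fin T, _)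
    .of_finite .of_finite]
  simp_rw [integral_reward_feedbackLaw]
  rw [integral_add .of_finite .of_finite]
  simp

lemma util_eq_sum (a : N → ℝ) (au : ℝ) (x : C → ℝ) (q : C → N → unitInterval) {p : Strategy C N}
    (hp : ∀ t H, IsProbabilityMeasure (p t H)) (T : ℕ) :
    util a au x q p T = ∑ t ∈ Finset.range T,
      ∫ H, ∫ c, score a au x (fun c v => (q c v : ℝ)) c ∂p t H ∂historyLaw q p t := by
  induction T with
  | zero => simp [util]
  | succ T ih => rw [util_succ a au x q hp, ih, Finset.sum_range_succ]

/-- Regret decomposition against a baseline `y` per step, later the optimal score: gaps weighted by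
expected numbers of plays. -/
lemma util_sub_eq_neg_sum (a : N → ℝ) (au : ℝ) (x : C → ℝ) (q : C → N → unitInterval)
    {p : Strategy C N} (hp : ∀ t H, IsProbabilityMeasure (p t H)) (y : ℝ) (T : ℕ) :
    util a au x q p T - T * y =
      -∑ c, (y - score a au x (fun c v => (q c v : ℝ)) c) *
        (∑ t ∈ Finset.range T, ∫⁻ H, p t H {c} ∂historyLaw q p t).toReal := by
  have hhist := fun t => isProbabilityMeasure_historyLaw q hp t
  have hfin : ∀ t c, ∫⁻ H, p t H {c} ∂historyLaw q p t ≠ ∞ := fun t c =>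
    ne_top_of_le_ne_top ENNReal.one_ne_top
      ((lintegral_mono fun H => prob_le_one (μ := p t H)).trans_eq (by simp))
  have hstep : ∀ t, ∫ H, ∫ c, score a au x (fun c v => (q c v : ℝ)) c ∂p t H ∂historyLaw q p t =
      y - ∑ c, (y - score a au x (fun c v => (q c v : ℝ)) c) *
        (∫⁻ H, p t H {c} ∂historyLaw q p t).toReal := by
    intro t
    have h1 : ∀ H, ∫ c, score a au x (fun c v => (q c v : ℝ)) c ∂p t H =
        y - ∑ c, (y - score a au x (fun c v => (q c v : ℝ)) c) * (p t H {c}).toReal := by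
      intro H
      have hc : ∫ c, (y - score a au x (fun c v => (q c v : ℝ)) c) ∂p t H =
          ∑ c, (y - score a au x (fun c v => (q c v : ℝ)) c) * (p t H {c}).toReal := by
        rw [integral_fintype .of_finite]
        simp [measureReal_def, mul_comm]
      rw [← hc, integral_sub .of_finite .of_finite]
      simp
    simp_rw [h1]
    rw [integral_sub .of_finite .of_finite, integral_finsetSum _ fun _ _ => .of_finite]
    simp_rw [integral_const_mul]
    congr 1
    · simp
    · refine Finset.sum_congr rfl fun c _ => ?_
      rw [integral_toReal (measurable_of_finite _).aemeasurable (by simp)]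
  rw [util_eq_sum a au x q hp]
  simp_rw [hstep, ENNReal.toReal_sum fun t _ => hfin t _, Finset.mul_sum]
  rw [Finset.sum_sub_distrib, Finset.sum_comm]
  simp

lemma isBigO_log_of_le {S : ℕ → ℝ≥0∞} {K r : ℝ≥0∞} (hK : K ≠ ∞) (hr : r < 1)
    (h : ∀ T L : ℕ, S T ≤ K + L + K * (T * r ^ L)) :
    (fun T => (S T).toReal) =O[atTop] fun T : ℕ => Real.log T := by
  -- Since `r` may be 0, the maximum keeps `s` positive and `-Real.log s` a valid divisor.
  set s := max r.toReal (1 / 2) with hs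
  have hs0 : 0 < s := lt_max_of_lt_right (by norm_num)
  have hs1 : s < 1 :=
    max_lt ((ENNReal.toReal_lt_toReal hr.ne_top ENNReal.one_ne_top).2 hr) (by norm_num)
  have hD : 0 < -Real.log s := neg_pos.2 (Real.log_neg hs0 hs1)
  refine IsBigO.of_bound (2 * K.toReal + 1 + 1 / -Real.log s) ?_
  filter_upwards [eventually_ge_atTop 3] with T hT
  have hT0 : (0 : ℝ) < T := by positivity
  have hlog : 1 ≤ Real.log T := by
    rw [Real.le_log_iff_exp_le hT0]
    have : (3 : ℝ) ≤ T := by exact_mod_cast hT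
    linarith [Real.exp_one_lt_d9]
  -- The least `L` with `T * s ^ L ≤ 1`.
  set L := ⌈Real.log T / -Real.log s⌉₊ with hL
  have hL1 : (L : ℝ) ≤ Real.log T / -Real.log s + 1 := (Nat.ceil_lt_add_one (by positivity)).le
  have hL2 : Real.log T ≤ L * -Real.log s := (div_le_iff₀ hD).1 (Nat.le_ceil _)
  have hpow : T * s ^ L ≤ 1 := by
    rw [← Real.exp_log hT0, ← Real.exp_log hs0, ← Real.exp_nat_mul, ← Real.exp_add,
      Real.exp_le_one_iff]
    linarith
  have hpow' : (T : ℝ) * r.toReal ^ L ≤ 1 := by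
    refine le_trans ?_ hpow
    gcongr
    exact le_max_left _ _
  have hbound : (S T).toReal ≤ K.toReal + L + K.toReal * (T * r.toReal ^ L) := by
    have hr' := hr.ne_top
    have h1 := ENNReal.toReal_mono (by finiteness) (h T L)
    rwa [ENNReal.toReal_add (by finiteness) (by finiteness), ENNReal.toReal_add hK (by finiteness),
      ENNReal.toReal_mul, ENNReal.toReal_mul, ENNReal.toReal_pow, ENNReal.toReal_natCast,
      ENNReal.toReal_natCast] at h1
  have hK0 : 0 ≤ K.toReal := ENNReal.toReal_nonneg
  rw [Real.norm_of_nonneg ENNReal.toReal_nonneg, Real.norm_of_nonneg (by linarith)]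
  calc (S T).toReal ≤ K.toReal + (Real.log T / -Real.log s + 1) + K.toReal * 1 := by
        refine hbound.trans ?_
        gcongr
    _ = (2 * K.toReal + 1) * 1 + 1 / -Real.log s * Real.log T := by ring
    _ ≤ (2 * K.toReal + 1) * Real.log T + 1 / -Real.log s * Real.log T := by gcongr
    _ = _ := by ring

end Posting

/-! ### Logarithmic regret -/

open Posting in
theorem corollary1 {C N : Type*} [Fintype C] [DecidableEq C] [MeasurableSpace C]
    [MeasurableSingletonClass C] [Fintype N]
    (a : N → ℝ) (au : ℝ) (x : C → ℝ) (q : C → N → unitInterval)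
    (ha : ∀ v, 0 ≤ a v) (hau : 0 ≤ au) (hsum : ∑ v, a v + au = 1)
    (hx : ∀ c, 0 ≤ x c ∧ x c ≤ 1)
    (α β : ℝ) (hα : 0 < α) (hβ : 0 < β)
    (sel : (C → ℝ) → C) (hsel : Posting.IsArgmaxRule sel) :
    (fun T : ℕ => Posting.regret sel a au x q α β T)
      =O[Filter.atTop] (fun T : ℕ => Real.log (T : ℝ)) := by
  set μ := score a au x fun c v => (q c v : ℝ) with hμ
  have hmax : ∀ c, μ c ≤ μ (sel μ) := hsel.2 μ
  have hps := isProbabilityMeasure_posteriorSampling (N := N) hsel a au x hα hβ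
  have hopt : ∀ t (H : History C N t),
      MeasureTheory.IsProbabilityMeasure (optimalStrategy sel a au x q t H) := fun t H => by
    unfold optimalStrategy; infer_instance
  have hutil : ∀ T, util a au x q (optimalStrategy sel a au x q) T = T * μ (sel μ) := by
    intro T
    have := isProbabilityMeasure_historyLaw q hopt
    rw [util_eq_sum a au x q hopt]
    simp [optimalStrategy, ← hμ]
  simp_rw [regret, hutil, util_sub_eq_neg_sum a au x q hps]
  refine Asymptotics.isBigO_neg_left.2 (Asymptotics.IsBigO.fun_sum fun c _ => ?_)
  -- Topics tied with the optimum may be played often, but their gap is zero.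
  rcases (hmax c).eq_or_lt with h | h
  · have h0 : μ (sel μ) - score a au x (fun c v => (q c v : ℝ)) c = 0 := sub_eq_zero.2 h.symm
    simp_rw [h0, zero_mul]
    exact Asymptotics.isBigO_zero _ _
  · obtain ⟨K, r, hK, hr, hbound⟩ :=
      exists_sum_lintegral_posteriorSampling_le ha hau hsum hα hβ hsel h
    exact (isBigO_log_of_le hK hr hbound).const_mul_left _
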